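/- All groups are finite. Let $\sigma=\{\sigma_i\mid i\in I\}$ be a partition of the set of all primes, and for a group $G$ let $\sigma(G)$ be the set of those $\sigma_i$ that contain a prime divisor of $|G|$. A Hall $\sigma_i$-subgroup of $G$ is a subgroup whose order is divisible only by primes in $\sigma_i$ and whose index is divisible by no prime in $\sigma_i$. A group $X$ is a $D_{\sigma_i}$-group if it has a Hall $\sigma_i$-subgroup, any two of these are conjugate, and every subgroup of $X$ whose order is divisible only by primes in $\sigma_i$ lies in one of them; $G$ is a $\sigma$-full group of Sylow type if every subgroup of $G$ is a $D_{\sigma_i}$-group for all $\sigma_i\in\sigma(G)$. A complete Hall $\sigma$-set of $G$ is a set $\mathcal H$ of subgroups of $G$ such that every non-identity member of $\mathcal H$ is a Hall $\sigma_i$-subgroup of $G$ for some $i$, and $\mathcal H$ contains exactly one Hall $\sigma_i$-subgroup of $G$ for every $\sigma_i\in\sigma(G)$. A subgroup $T$ of $G$ is $\sigma$-subnormal if there is a chain $T=A_0\le A_1\le\cdots\le A_n=G$ such that for each $i\in\{1,\dots,n\}$ either $A_{i-1}\trianglelefteq A_i$ or $|\sigma(A_i/(A_{i-1})_{A_i})|\le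 1$, where $(A_{i-1})_{A_i}$ is the core of $A_{i-1}$ in $A_i$. A subgroup $M$ is modular in $G$ if $\langle X,M\cap Z\rangle=\langle X,M\rangle\cap Z$ for all $X\le Z\le G$, and $\langle M,Y\cap Z\rangle=\langle M,Y\rangle\cap Z$ for all $Y,Z\le G$ with $M\le Z$. Given a complete Hall $\sigma$-set $\mathcal H$ of $G$, a subgroup $B$ is $\mathcal H$-permutable if $BA=AB$ for all $A\in\mathcal H$; a subgroup $S$ is $m$-$\mathcal H$-permutable if $S=\langle A,B\rangle$ for some modular subgroup $A$ and some $\mathcal H$-permutable subgroup $B$ of $G$; and a subgroup $H$ is weakly $m$-$\mathcal H$-permutable in $G$ if there are a $\sigma$-subnormal subgroup $T$ of $G$ and an $m$-$\mathcal H$-permutable subgroup $S$ of $G$ with $G=HT$ and $H\cap T\le S\le H$. Let $Z_\infty(G)$ denote the hypercenter of $G$, that is, the final term of its upper central series. **Proposition.** Let $G$ be a non-trivial $\sigma$-full group of Sylow type and $\mathcal H$ a complete Hall $\sigma$-set of $G$ such that every member of $\mathcal H$ is supersoluble. Let $p$ be the smallest prime dividing $|G|$. Suppose that every cyclic subgroup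 $H$ of $G$ with $H\nleq Z_\infty(G)$ that has order $p$, or has order $4$ in case $p=2$ and a Sylow $2$-subgroup of $G$ is non-abelian, is weakly $m$-$\mathcal H$-permutable in $G$. Then $G$ is $p$-nilpotent, that is, $G$ has a normal subgroup of order prime to $p$ and of $p$-power index. -/

import Mathlib

open scoped Pointwise

/-- `π(n) ⊆ π`: every prime dividing `n` lies in `π`. -/
def IsPiNumber (π : Set Nat.Primes) (n : ℕ) : Prop :=
  ∀ q : Nat.Primes, (q : ℕ) ∣ n → q ∈ π

/-- `H` is a Hall `π`-subgroup of `G`: `|H|` is a `π`-number and `|G : H|` is a `π'`-number. -/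
def IsHallSubgroup {G : Type*} [Group G] (π : Set Nat.Primes) (H : Subgroup G) : Prop :=
  IsPiNumber π (Nat.card H) ∧ IsPiNumber πᶜ H.index

/-- `G` is a `D_π`-group: `G` has a Hall `π`-subgroup, any two Hall `π`-subgroups are conjugate,
and every `π`-subgroup is contained in a Hall `π`-subgroup. -/
def IsDGroup (π : Set Nat.Primes) (G : Type*) [Group G] : Prop :=
  (∃ H : Subgroup G, IsHallSubgroup π H) ∧
  (∀ H K : Subgroup G, IsHallSubgroup π H → IsHallSubgroup π K →
    ∃ g : G, K = H.map (MulAut.conj g).toMonoidHom) ∧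
  (∀ K : Subgroup G, IsPiNumber π (Nat.card K) → ∃ H : Subgroup G, IsHallSubgroup π H ∧ K ≤ H)

/-- `σ(G)`: the blocks of `σ` containing a prime divisor of `|G|`. -/
def sigmaSupport (σ : Set (Set Nat.Primes)) (G : Type*) [Group G] : Set (Set Nat.Primes) :=
  {s | s ∈ σ ∧ ∃ q ∈ s, (q : ℕ) ∣ Nat.card G}

/-- `G` is `σ`-primary: `|σ(G)| ≤ 1`. -/
def IsSigmaPrimary (σ : Set (Set Nat.Primes)) (G : Type*) [Group G] : Prop :=
  (sigmaSupport σ G).Subsingleton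

/-- `G` is a `σ`-full group of Sylow type: every subgroup of `G` is a `D_s`-group for all
`s ∈ σ(G)`. -/
def IsSigmaFullOfSylowType (σ : Set (Set Nat.Primes)) (G : Type*) [Group G] : Prop :=
  ∀ E : Subgroup G, ∀ s ∈ sigmaSupport σ G, IsDGroup s E

/-- `𝓗` is a complete Hall `σ`-set of `G`. -/
def IsCompleteHallSet {G : Type*} [Group G] (σ : Set (Set Nat.Primes))
    (𝓗 : Set (Subgroup G)) : Prop :=
  (∀ A ∈ 𝓗, A ≠ ⊥ → ∃ s ∈ σ, IsHallSubgroup s A) ∧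
  ∀ s ∈ sigmaSupport σ G, ∃! A : Subgroup G, A ∈ 𝓗 ∧ IsHallSubgroup s A

/-- `H` is `σ`-subnormal in `G`: there is a chain `H = A 0 ≤ A 1 ≤ ⋯ ≤ A n = G` such that, for each
`i < n`, either `A i` is normal in `A (i + 1)`, or the quotient of `A (i + 1)` by the core of `A i`
in `A (i + 1)` is `σ`-primary. -/
def IsSigmaSubnormal {G : Type*} [Group G] (σ : Set (Set Nat.Primes)) (H : Subgroup G) : Prop :=
  ∃ (n : ℕ) (A : ℕ → Subgroup G), A 0 = H ∧ A n = ⊤ ∧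
    ∀ i < n, A i ≤ A (i + 1) ∧
      (((A i).subgroupOf (A (i + 1))).Normal ∨
        IsSigmaPrimary σ (A (i + 1) ⧸ ((A i).subgroupOf (A (i + 1))).normalCore))

/-- `M` is a modular subgroup of `G` in the sense of Kurosh: a modular element of the subgroup
lattice of `G`. -/
def IsModularSubgroup {G : Type*} [Group G] (M : Subgroup G) : Prop :=
  (∀ X Z : Subgroup G, X ≤ Z → X ⊔ (M ⊓ Z) = (X ⊔ M) ⊓ Z) ∧
  (∀ Y Z : Subgroup G, M ≤ Z → M ⊔ (Y ⊓ Z) = (M ⊔ Y) ⊓ Z)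

/-- `H` is `𝓗`-permutable: `HA = AH` for all `A ∈ 𝓗`. -/
def IsHPermutable {G : Type*} [Group G] (𝓗 : Set (Subgroup G)) (H : Subgroup G) : Prop :=
  ∀ A ∈ 𝓗, (H : Set G) * (A : Set G) = (A : Set G) * (H : Set G)

/-- `H` is `m`-`𝓗`-permutable: `H = ⟨A, B⟩` with `A` modular and `B` `𝓗`-permutable. -/
def IsMHPermutable {G : Type*} [Group G] (𝓗 : Set (Subgroup G)) (H : Subgroup G) : Prop :=
  ∃ A B : Subgroup G, IsModularSubgroup A ∧ IsHPermutable 𝓗 B ∧ H = A ⊔ B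

/-- `H` is weakly `m`-`𝓗`-permutable in `G`: there are a `σ`-subnormal `T` and an
`m`-`𝓗`-permutable `S` with `G = HT` and `H ∩ T ≤ S ≤ H`. -/
def IsWeaklyMHPermutable {G : Type*} [Group G] (σ : Set (Set Nat.Primes))
    (𝓗 : Set (Subgroup G)) (H : Subgroup G) : Prop :=
  ∃ T : Subgroup G, IsSigmaSubnormal σ T ∧ (H : Set G) * (T : Set G) = Set.univ ∧
    ∃ S : Subgroup G, IsMHPermutable 𝓗 S ∧ H ⊓ T ≤ S ∧ S ≤ H

/-- `G` is supersoluble: it has a finite series of normal subgroups of `G` from `1` to `G` with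
cyclic factors. -/
def IsSupersoluble (G : Type*) [Group G] : Prop :=
  ∃ (n : ℕ) (N : ℕ → Subgroup G) (_ : ∀ i, (N i).Normal), N 0 = ⊥ ∧ N n = ⊤ ∧
    ∀ i < n, N i ≤ N (i + 1) ∧ IsCyclic (N (i + 1) ⧸ (N i).subgroupOf (N (i + 1)))

/-- `Z_∞(G)`: for a finite group, the union (final term) of the upper central series. -/
def hypercenter (G : Type*) [Group G] : Subgroup G :=
  ⨆ n : ℕ, Subgroup.upperCentralSeries G n

/-- `G` is `p`-nilpotent: it has a normal `p`-complement. -/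
def IsPNilpotent (p : ℕ) (G : Type*) [Group G] : Prop :=
  ∃ N : Subgroup G, N.Normal ∧ ¬ p ∣ Nat.card N ∧ ∃ k : ℕ, N.index = p ^ k

/-! By Frobenius's criterion it suffices that a `q`-element `y`, `q ≠ p`, normalizing a `p`-subgroup
`X` centralizes it. Since `p` is smallest, `q > p`; after conjugation `y` lies in a supersoluble
Hall subgroup `A ∈ 𝓗`.

A coprime action on a `p`-group is trivial once it fixes the displacements `x⁻¹ φ(x)` of exponent
`p` (exponent `4` too, if `p = 2` and the group is non-abelian). Here the displacements are
commutators `[x⁻¹, y]`, so only elements `z` of the derived group `G'` matter.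

For such a `z` outside the hypercenter, any supplement `T` in the weak permutability of `⟨z⟩` is all
of `G`. If `p = 2` and `T` is proper, `z` is a single cycle of even length on `G/T`, an odd
permutation, which no element of `G'` can be. If `p` is odd and `T` is proper, `T` is normal of
index `p`, so it contains `G'` and hence `z`. Therefore `⟨z⟩` is the join of a modular and an
`𝓗`-permutable subgroup and, being a cyclic `p`-group, equals one of them. In either case, as for
hypercentral `z`, `y` commutes with `z`, because the automorphism group of a cyclic `p`-group has no
prime divisor above `p`, or because a commutator falls into a `p'`-subgroup. -/

open scoped commutatorElement

/-! ### Fusion and Frobenius's criterion -/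

/-- Every element of `q`-power order, `q ≠ p`, normalizing a `p`-subgroup centralizes it. -/
def CentralizesNormalizedPSubgroups (p : ℕ) (G : Type*) [Group G] : Prop :=
  ∀ X : Subgroup G, IsPGroup p X → ∀ q : ℕ, q.Prime → q ≠ p → ∀ (y : G) (k : ℕ),
    y ^ q ^ k = 1 → y ∈ Subgroup.normalizer (X : Set G) → ∀ x ∈ X, Commute y x

theorem CentralizesNormalizedPSubgroups.subgroup {p : ℕ} {G : Type*} [Group G]
    (hG : CentralizesNormalizedPSubgroups p G) (K : Subgroup G) :
    CentralizesNormalizedPSubgroups p K := by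
  intro X hX q hq hqp y k hyk hy x hx
  have h := hG (X.map K.subtype) (hX.map _) q hq hqp y k (by exact_mod_cast congrArg Subtype.val hyk)
    (Subgroup.le_normalizer_map K.subtype ⟨y, hy, rfl⟩) x ⟨x, hx, rfl⟩
  exact Subtype.ext h

theorem Subgroup.mem_of_pow_mem_of_coprime {G : Type*} [Group G] {M : Subgroup G} {x : G}
    {a b : ℕ} (ha : x ^ a ∈ M) (hb : x ^ b ∈ M) (hab : a.Coprime b) : x ∈ M := by
  have h : x = (x ^ a) ^ (a.gcdA b) * (x ^ b) ^ (a.gcdB b) := by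
    have := Nat.gcd_eq_gcd_ab a b
    rw [hab.gcd_eq_one] at this
    rw [← zpow_natCast, ← zpow_natCast, ← zpow_mul, ← zpow_mul, ← zpow_add, ← this]
    simp
  rw [h]
  exact M.mul_mem (M.zpow_mem ha _) (M.zpow_mem hb _)

/-- The normalizer of a `p`-subgroup is the product of its centralizer and any Sylow `p`-subgroup
of the normalizer. -/
theorem CentralizesNormalizedPSubgroups.exists_eq_mul {p : ℕ} [hp : Fact p.Prime] {G : Type*}
    [Group G] [Finite G] (hG : CentralizesNormalizedPSubgroups p G) {D : Subgroup G}
    (hD : IsPGroup p D) (S : Sylow p (Subgroup.normalizer (D : Set G)))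
    (n : Subgroup.normalizer (D : Set G)) :
    ∃ c : Subgroup.normalizer (D : Set G), (c : G) ∈ Subgroup.centralizer (D : Set G) ∧
      ∃ s ∈ S, n = c * s := by
  let C : Subgroup (Subgroup.normalizer (D : Set G)) :=
    (Subgroup.centralizer (D : Set G)).subgroupOf _
  have hC : C.Normal := by
    have : C = (Subgroup.normalizerMonoidHom D).ker := (Subgroup.normalizerMonoidHom_ker D).symm
    rw [this]; infer_instance
  -- No prime divides the index: `S` excludes `p`, and for `q ≠ p` a whole Sylow `q`-subgroup lies
  -- in `C`.
  have htop : C ⊔ S = ⊤ := by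
    rw [← Subgroup.index_eq_one]
    by_contra hne
    obtain ⟨q, hq, hqd⟩ := Nat.exists_prime_and_dvd hne
    have hqp : q ≠ p := by
      rintro rfl
      exact S.not_dvd_index (hqd.trans (Subgroup.index_dvd_of_le le_sup_right))
    have := Fact.mk hq
    let Q : Sylow q (Subgroup.normalizer (D : Set G)) := default
    have hQ : (Q : Subgroup _) ≤ C := by
      intro y hy
      obtain ⟨k, hk⟩ := Q.2 ⟨y, hy⟩
      have hk' : y ^ q ^ k = 1 := congrArg Subtype.val hk
      rw [Subgroup.mem_subgroupOf, Subgroup.mem_centralizer_iff]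
      intro x hx
      exact (hG D hD q hq hqp y k (by exact_mod_cast congrArg Subtype.val hk') y.2 x hx).eq.symm
    exact Q.not_dvd_index (hqd.trans (Subgroup.index_dvd_of_le (hQ.trans le_sup_left)))
  have hn : n ∈ C ⊔ S := htop ▸ Subgroup.mem_top n
  obtain ⟨c, hc, s, hs, rfl⟩ := Subgroup.mem_sup_of_normal_left.1 hn
  exact ⟨c, hc, s, hs, rfl⟩

/-- Two Sylow `p`-subgroups of the normalizer of a `p`-subgroup are conjugate under its
centralizer. -/
theorem CentralizesNormalizedPSubgroups.exists_smul_eq {p : ℕ} [hp : Fact p.Prime] {G : Type*}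
    [Group G] [Finite G] (hG : CentralizesNormalizedPSubgroups p G) {D : Subgroup G}
    (hD : IsPGroup p D) (S T : Sylow p (Subgroup.normalizer (D : Set G))) :
    ∃ c : Subgroup.normalizer (D : Set G), (c : G) ∈ Subgroup.centralizer (D : Set G) ∧
      c • S = T := by
  obtain ⟨n, rfl⟩ := MulAction.exists_smul_eq (Subgroup.normalizer (D : Set G)) S T
  obtain ⟨c, hc, s, hs, rfl⟩ := hG.exists_eq_mul hD S n
  refine ⟨c, hc, ?_⟩
  rw [mul_smul, Sylow.smul_eq_iff_mem_normalizer.2 (Subgroup.le_normalizer hs)]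

theorem IsPGroup.lt_inf_normalizer {p : ℕ} [hp : Fact p.Prime] {G : Type*} [Group G] [Finite G]
    {D P : Subgroup G} (hP : IsPGroup p P) (hDP : D < P) :
    D < P ⊓ Subgroup.normalizer (D : Set G) := by
  refine lt_of_le_of_ne (le_inf hDP.le Subgroup.le_normalizer) fun heq => ?_
  have := hP.isNilpotent
  have hnc : NormalizerCondition P := Group.normalizerCondition_of_isNilpotent
  have hlt : D.subgroupOf P < ⊤ := by
    rw [lt_top_iff_ne_top, Ne, Subgroup.subgroupOf_eq_top]
    exact not_le_of_gt hDP
  obtain ⟨x, hx, hxD⟩ := SetLike.exists_of_lt (hnc _ hlt)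
  apply hxD
  rw [Subgroup.mem_subgroupOf, heq]
  refine ⟨x.2, ?_⟩
  have := Subgroup.le_normalizer_map P.subtype ⟨x, hx, rfl⟩
  rwa [Subgroup.subgroupOf_map_subtype, inf_of_le_left hDP.le] at this

theorem Sylow.eq_of_le {p : ℕ} {G : Type*} [Group G] {P Q : Sylow p G}
    (h : (P : Subgroup G) ≤ Q) : P = Q :=
  Sylow.ext (P.3 Q.2 h).symm

/-- Any two Sylow `p`-subgroups are conjugate under the centralizer of their intersection. -/
theorem CentralizesNormalizedPSubgroups.sylow_conj {p : ℕ} [hp : Fact p.Prime] {G : Type*}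
    [Group G] [Finite G] (hG : CentralizesNormalizedPSubgroups p G) (P Q : Sylow p G) :
    ∃ c ∈ Subgroup.centralizer ((P ⊓ Q : Subgroup G) : Set G), c • Q = P := by
  -- Downward induction on `|P ∩ Q|`. Normalizers grow in `p`-groups, so Sylow subgroups of `N(D)`
  -- can be chosen meeting `P` and `Q` in more than `D`. They are conjugate under `C(D)`, and the
  -- induction hypothesis links them to `P` and `Q`.
  induction hm : Nat.card G - Nat.card (P ⊓ Q : Subgroup G) using Nat.strong_induction_on
    generalizing P Q with
  | _ m ih =>
  by_cases hPQ : P = Q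
  · exact ⟨1, one_mem _, by simp [hPQ]⟩
  set D : Subgroup G := P ⊓ Q with hDdef
  have hDP : D < P := lt_of_le_of_ne inf_le_left fun h => hPQ (Sylow.eq_of_le (inf_eq_left.1 h))
  have hDQ : D < Q := lt_of_le_of_ne inf_le_right fun h =>
    hPQ (Sylow.eq_of_le (inf_eq_right.1 h)).symm
  have hD : IsPGroup p D := P.2.to_le inf_le_left
  have key : ∀ R S : Sylow p G, D < (R : Subgroup G) ⊓ S →
      ∃ c ∈ Subgroup.centralizer (D : Set G), c • S = R := by
    intro R S hlt
    have h1 : Nat.card D < Nat.card (R ⊓ S : Subgroup G) :=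
      Set.ncard_lt_ncard (SetLike.coe_ssubset_coe.2 hlt)
    have h2 : Nat.card (R ⊓ S : Subgroup G) ≤ Nat.card G := Subgroup.card_le_card_group _
    obtain ⟨c, hc, h⟩ := ih _ (by omega) R S rfl
    exact ⟨c, Subgroup.centralizer_le (SetLike.coe_subset_coe.2 hlt.le) hc, h⟩
  set N := Subgroup.normalizer (D : Set G) with hN
  have hsub : ∀ R : Sylow p G, D < R → ∃ S : Sylow p N, D < (R : Subgroup G) ⊓ (S : Subgroup N).map N.subtype := by
    intro R hDR
    have hp1 : IsPGroup p ((R ⊓ N : Subgroup G).subgroupOf N) :=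
      (R.2.to_le inf_le_left : IsPGroup p (R ⊓ N : Subgroup G)).comap_subtype
    obtain ⟨S, hS⟩ := hp1.exists_le_sylow
    refine ⟨S, (R.2.lt_inf_normalizer hDR).trans_le (le_inf inf_le_left ?_)⟩
    have := Subgroup.map_mono (f := N.subtype) hS
    rwa [Subgroup.subgroupOf_map_subtype, inf_of_le_left inf_le_right] at this
  obtain ⟨S, hS⟩ := hsub P hDP
  obtain ⟨T, hT⟩ := hsub Q hDQ
  obtain ⟨c, hc, hcST⟩ := hG.exists_smul_eq hD T S
  have hTp : IsPGroup p ((T : Subgroup N).map N.subtype) := T.2.map _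
  obtain ⟨R, hR⟩ := hTp.exists_le_sylow
  obtain ⟨c₁, hc₁, h₁⟩ := key R Q
    (hT.trans_le (le_inf (inf_le_right.trans hR) inf_le_left))
  have hSR : (S : Subgroup N).map N.subtype ≤ ((c : G) • R : Sylow p G) := by
    rw [← hcST]
    rintro _ ⟨_, ⟨t, ht, rfl⟩, rfl⟩
    exact ⟨t, hR ⟨t, ht, rfl⟩, rfl⟩
  obtain ⟨c₂, hc₂, h₂⟩ := key P ((c : G) • R) (hS.trans_le (inf_le_inf_left _ hSR))
  refine ⟨c₂ * (c * c₁), mul_mem hc₂ (mul_mem hc hc₁), ?_⟩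
  rw [mul_smul, mul_smul, h₁, h₂]

/-- Under the hypothesis of Frobenius's criterion a Sylow subgroup controls its own fusion. -/
theorem CentralizesNormalizedPSubgroups.exists_conj_eq {p : ℕ} [hp : Fact p.Prime] {G : Type*}
    [Group G] [Finite G] (hG : CentralizesNormalizedPSubgroups p G) (P : Sylow p G) {x g : G}
    (hx : x ∈ P) (hgx : g * x * g⁻¹ ∈ P) : ∃ v ∈ P, g * x * g⁻¹ = v * x * v⁻¹ := by
  obtain ⟨c, hc, hcP⟩ := hG.sylow_conj P (g • P)
  have hmem : g * x * g⁻¹ ∈ (P ⊓ (g • P : Sylow p G) : Subgroup G) := ⟨hgx, x, hx, rfl⟩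
  have hcg : c * g ∈ Subgroup.normalizer (P : Set G) := by
    rw [← Sylow.smul_eq_iff_mem_normalizer, mul_smul, hcP]
  -- `N(P) = C(P) P`, so modulo elements centralizing `g x g⁻¹` the conjugation by `g` is one by `s
  -- ∈ P`.
  obtain ⟨d, hd, s, hs, hds⟩ := hG.exists_eq_mul P.2 (P.subtype Subgroup.le_normalizer) ⟨_, hcg⟩
  have hds' : c * g = d * s := congrArg Subtype.val hds
  have hsP : (s : G) ∈ P := hs
  refine ⟨s, hsP, ?_⟩
  have h1 := Subgroup.mem_centralizer_iff.1 hc _ hmem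
  have h2 := Subgroup.mem_centralizer_iff.1 hd _ (mul_mem (mul_mem hsP hx) (inv_mem hsP))
  calc g * x * g⁻¹ = c * (g * x * g⁻¹) * c⁻¹ := by rw [← h1, mul_inv_cancel_right]
    _ = (c * g) * x * (c * g)⁻¹ := by group
    _ = d * (s * x * (s : G)⁻¹) * (d : G)⁻¹ := by rw [hds']; simp only [mul_assoc, mul_inv_rev]
    _ = s * x * (s : G)⁻¹ := by rw [← h2, mul_inv_cancel_right]

/-- **Frobenius's criterion** for the existence of a normal `p`-complement. -/
theorem CentralizesNormalizedPSubgroups.isPNilpotent {p : ℕ} [hp : Fact p.Prime] {G : Type*}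
    [Group G] [Finite G] (hG : CentralizesNormalizedPSubgroups p G) : IsPNilpotent p G := by
  induction hm : Nat.card G using Nat.strong_induction_on generalizing G with
  | _ m ih =>
  by_cases hpG : p ∣ Nat.card G
  swap
  · exact ⟨⊤, inferInstance, by rwa [Subgroup.card_top], 0, by simp⟩
  let P : Sylow p G := default
  -- Control of fusion turns each generator `[x, u]` of the focal subgroup into `[x, v]` with `v ∈
  -- P`, so the focal subgroup lies in `P'`, which is proper in the nilpotent group `P`. The
  -- transfer kernel is then a proper normal subgroup of `p`-power index.
  have hfoc : P.focalSubgroup < (P : Subgroup G) := by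
    refine lt_of_le_of_lt (b := ⁅(P : Subgroup G), (P : Subgroup G)⁆) ?_ ?_
    · rw [Subgroup.focalSubgroup_def, Subgroup.closure_le]
      rintro _ ⟨hmem, x, hx, u, rfl⟩
      have hux : u * x⁻¹ * u⁻¹ ∈ P := by
        have : x⁻¹ * ⁅x, u⁆ ∈ (P : Subgroup G) := mul_mem (inv_mem hx) hmem
        change _ ∈ (P : Subgroup G)
        simpa [commutatorElement_def, mul_assoc] using this
      obtain ⟨v, hv, h⟩ := hG.exists_conj_eq P (inv_mem hx) hux
      have : ⁅x, u⁆ = ⁅x, v⁆ := by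
        rw [commutatorElement_def, commutatorElement_def]
        simpa [mul_assoc] using h
      rw [SetLike.mem_coe, this]
      exact Subgroup.commutator_mem_commutator hx hv
    · have := P.2.isNilpotent
      have hsol : Group.IsSolvable P := inferInstance
      have : Nontrivial P := (Subgroup.nontrivial_iff_ne_bot _).2 (P.ne_bot_of_dvd_card hpG)
      have hlt := Group.IsSolvable.commutator_lt_top_of_nontrivial P
      rw [← Subgroup.map_subtype_commutator]
      exact (Subgroup.map_lt_map_iff_of_injective (P : Subgroup G).subtype_injective).2 hlt |>.trans_le
        (Subgroup.map_subtype_le _)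
  let K := P.transferFocal.ker
  have hKtop : K ≠ ⊤ := by
    intro h
    have := Subgroup.ker_transferFocal_inf_eq_focalSubgroup P
    rw [show P.transferFocal.ker = ⊤ from h, top_inf_eq] at this
    exact hfoc.ne this.symm
  have hKcard : Nat.card K < m := by
    rw [← hm, ← Subgroup.card_top (G := G)]
    exact Set.ncard_lt_ncard (SetLike.coe_ssubset_coe.2 (lt_top_iff_ne_top.2 hKtop))
  obtain ⟨j, hj⟩ : ∃ j, K.index = p ^ j := by
    rw [Subgroup.index_ker]
    exact (IsPGroup.iff_card.1 (P.2.to_quotient _)).imp fun _ h => by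
      rw [MonoidHom.range_eq_top.2 (Subgroup.transferFocal_surjective P), Subgroup.card_top, h]
  obtain ⟨M, hM, hMp, k, hk⟩ := ih _ hKcard (hG.subgroup K) rfl
  refine ⟨M.map K.subtype, ⟨?_⟩, ?_, k + j, ?_⟩
  · rintro _ ⟨x, hx, rfl⟩ g
    have hgx : g * x * g⁻¹ ∈ K := (inferInstance : K.Normal).conj_mem _ x.2 g
    refine ⟨⟨_, hgx⟩, ?_, rfl⟩
    -- `M` contains every element of `K` of order dividing `|M|`, because `|M|` and `|K : M|` are
    -- coprime; hence it is stable under conjugation by `G`.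
    refine Subgroup.mem_of_pow_mem_of_coprime (a := Nat.card M) (b := M.index) ?_
      (Subgroup.pow_index_mem _ _) ?_
    · have h1 : x ^ Nat.card M = 1 :=
        congrArg Subtype.val (pow_card_eq_one' (x := (⟨x, hx⟩ : M)))
      have h2 : (⟨_, hgx⟩ : K) ^ Nat.card M = 1 := by
        refine Subtype.ext ?_
        have h3 : (x : G) ^ Nat.card M = 1 := by exact_mod_cast congrArg Subtype.val h1
        simp [h3]
      rw [h2]
      exact one_mem _
    · rw [hk]
      exact Nat.Coprime.pow_right _ ((Nat.Prime.coprime_iff_not_dvd hp.out).2 hMp).symm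
  · rwa [Subgroup.card_map_of_injective K.subtype_injective]
  · rw [Subgroup.index_map_subtype, hk, hj, pow_add]

/-! ### Coprime action on a `p`-group -/

/-- Collecting the `a`'s to the left in `(ab)^k` takes `k.choose 2` exchanges, each leaving one
central factor `c`. -/
theorem mul_pow_eq_of_commute_commutator {G : Type*} [Group G] {a b c : G} (hca : Commute c a)
    (hcb : Commute c b) (h : b * a = a * b * c) (k : ℕ) :
    (a * b) ^ k = a ^ k * b ^ k * c ^ k.choose 2 := by
  have hb : ∀ k : ℕ, b ^ k * a = a * b ^ k * c ^ k := by
    intro k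
    induction k with
    | zero => simp
    | succ k ih =>
      rw [pow_succ' b, mul_assoc, ih, pow_succ' c, ← mul_assoc, ← mul_assoc, h]
      simp only [mul_assoc]
      rw [← mul_assoc c (b ^ k), (hcb.pow_right k).eq, mul_assoc]
  induction k with
  | zero => simp
  | succ k ih =>
    have h1 : c ^ k.choose 2 * (a * b) = a * b * c ^ k.choose 2 :=
      ((hca.pow_left _).mul_right (hcb.pow_left _)).eq
    have h2 : c ^ k * b = b * c ^ k := (hcb.pow_left k).eq
    rw [pow_succ, ih, mul_assoc, h1, Nat.choose_succ_succ' k 1, Nat.choose_one_right, pow_add c]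
    calc a ^ k * b ^ k * (a * b * c ^ k.choose 2)
        = a ^ k * (b ^ k * a) * b * c ^ k.choose 2 := by simp only [mul_assoc]
      _ = a ^ k * a * b ^ k * (c ^ k * b) * c ^ k.choose 2 := by rw [hb]; simp only [mul_assoc]
      _ = a ^ (k + 1) * b ^ (k + 1) * (c ^ k * c ^ k.choose 2) := by
        rw [h2, pow_succ a, pow_succ b]; simp only [mul_assoc]

/-- If an endomorphism of period `n` fixes the displacement `x⁻¹ φ(x)`, whose order is prime to `n`,
then it fixes `x`. -/
theorem MonoidHom.apply_eq_of_apply_displacement_eq {G : Type*} [Group G] (φ : G →* G) {n m : ℕ}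
    {x : G} (hn : φ^[n] x = x) (hfix : φ (x⁻¹ * φ x) = x⁻¹ * φ x) (hm : (x⁻¹ * φ x) ^ m = 1)
    (hnm : n.Coprime m) : φ x = x := by
  set w := x⁻¹ * φ x with hw
  have hφx : φ x = x * w := by rw [hw]; group
  have hiter : ∀ k : ℕ, φ^[k] x = x * w ^ k := by
    intro k
    induction k with
    | zero => simp
    | succ k ih => rw [Function.iterate_succ_apply', ih, map_mul, map_pow, hfix, hφx, pow_succ',
        mul_assoc]
  have h1 : w ^ n = 1 := by
    have := hiter n
    rw [hn] at this
    exact (left_eq_mul.1 this)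
  have h2 : w = 1 := by
    have := pow_gcd_eq_one.2 ⟨h1, hm⟩
    rwa [hnm.gcd_eq_one, pow_one] at this
  rw [hφx, h2, mul_one]

theorem Subgroup.commutator_le_of_index_prime {G : Type*} [Group G] {N : Subgroup G} [N.Normal]
    {p : ℕ} (hp : p.Prime) (h : N.index = p) : _root_.commutator G ≤ N := by
  have := Fact.mk hp
  have hcyc : IsCyclic (G ⧸ N) := isCyclic_of_prime_card (p := p) h
  rw [← Subgroup.Normal.quotient_commutative_iff_commutator_le]
  exact ⟨⟨fun a b => (IsCyclic.isMulCommutative (α := G ⧸ N)).is_comm.comm a b⟩⟩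

/-- Sylow's theorem gives a subgroup above `M` larger by exactly a factor `p`; maximality makes it
the whole group. -/
theorem IsPGroup.index_of_isCoatom {p : ℕ} [hp : Fact p.Prime] {P : Type*} [Group P] [Finite P]
    (hP : IsPGroup p P) {M : Subgroup P} (hM : IsCoatom M) : M.index = p := by
  obtain ⟨m, hm⟩ := IsPGroup.iff_card.1 (hP.to_subgroup M)
  obtain ⟨j, hj⟩ := hP.index M
  have hj0 : j ≠ 0 := by
    rintro rfl
    exact hM.1 (Subgroup.index_eq_one.1 hj)
  have hcard := M.card_mul_index
  rw [hm, hj, ← pow_add] at hcard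
  obtain ⟨K, hK, hMK⟩ := Sylow.exists_subgroup_card_pow_succ (G := P) (n := m)
    (hcard ▸ pow_dvd_pow p (by omega)) hm
  have hKtop : K = ⊤ := by
    refine hM.2 K (lt_of_le_of_ne hMK fun h => ?_)
    rw [← h, hm] at hK
    exact absurd (Nat.pow_right_injective hp.out.two_le hK) (by omega)
  rw [hKtop, Subgroup.card_top, ← hcard] at hK
  have := Nat.pow_right_injective hp.out.two_le hK
  rw [hj, show j = 1 by omega, pow_one]

theorem IsPGroup.pow_mem_frattini {p : ℕ} [hp : Fact p.Prime] {P : Type*} [Group P] [Finite P]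
    (hP : IsPGroup p P) (a : P) : a ^ p ∈ frattini P := by
  have := hP.isNilpotent
  simp only [frattini, Order.radical, Subgroup.mem_iInf]
  intro M hM
  have : M.Normal := Subgroup.NormalizerCondition.normal_of_coatom M
    Group.normalizerCondition_of_isNilpotent hM
  exact hP.index_of_isCoatom hM ▸ M.pow_index_mem a

theorem IsPGroup.commutator_mem_frattini {p : ℕ} [hp : Fact p.Prime] {P : Type*} [Group P]
    [Finite P] (hP : IsPGroup p P) (a b : P) : ⁅a, b⁆ ∈ frattini P := by
  have := hP.isNilpotent
  simp only [frattini, Order.radical, Subgroup.mem_iInf]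
  intro M hM
  have : M.Normal := Subgroup.NormalizerCondition.normal_of_coatom M
    Group.normalizerCondition_of_isNilpotent hM
  exact Subgroup.commutator_le_of_index_prime hp.out (hP.index_of_isCoatom hM)
    (Subgroup.commutator_mem_commutator (Subgroup.mem_top a) (Subgroup.mem_top b))

theorem frattini_ne_top {P : Type*} [Group P] [Finite P] [Nontrivial P] : frattini P ≠ ⊤ := by
  intro h
  have := frattini_nongenerating (K := (⊥ : Subgroup P)) (by rw [h, sup_top_eq])
  exact bot_ne_top this

/-- An endomorphism `φ` of a finite `p`-group of period prime to `p` is trivial, provided that it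
fixes the displacements `x⁻¹ φ(x)` of exponent `p` and, if `p = 2` and the group is not abelian,
those of exponent `4`. -/
theorem IsPGroup.apply_eq_of_iterate_eq {p : ℕ} [hp : Fact p.Prime] {P : Type*} [Group P]
    [Finite P] (hP : IsPGroup p P) (φ : P →* P) {n : ℕ} (hn : ∀ x, φ^[n] x = x)
    (hnp : n.Coprime p)
    (hfix : ∀ x, ((x⁻¹ * φ x) ^ p = 1 ∨
      (p = 2 ∧ (∃ a b : P, a * b ≠ b * a) ∧ (x⁻¹ * φ x) ^ 4 = 1)) →
      φ (x⁻¹ * φ x) = x⁻¹ * φ x) (x : P) : φ x = x := by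
  induction hm : Nat.card P using Nat.strong_induction_on generalizing P with
  | _ m ih =>
  have hinv : ∀ H : Subgroup P, H ≠ ⊤ → (∀ x ∈ H, φ x ∈ H) → ∀ x ∈ H, φ x = x := by
    intro H hH hφH x hx
    let ψ : H →* H := (φ.domRestrict H).codRestrict H fun x => hφH x x.2
    have hψ : ∀ x : H, (ψ x : P) = φ x := fun _ => rfl
    have hiter : ∀ (k : ℕ) (x : H), ((ψ^[k] x : H) : P) = φ^[k] x := by
      intro k x
      induction k with
      | zero => rfl
      | succ k ih => rw [Function.iterate_succ_apply', Function.iterate_succ_apply', hψ, ih]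
    have hlt : Nat.card H < m := by
      rw [← hm, ← Subgroup.card_top (G := P)]
      exact Set.ncard_lt_ncard (SetLike.coe_ssubset_coe.2 (lt_top_iff_ne_top.2 hH))
    have := ih _ hlt (hP.to_subgroup H) ψ (fun x => Subtype.ext (by rw [hiter, hn])) ?_ ⟨x, hx⟩ rfl
    · exact congrArg Subtype.val this
    · intro z hz
      refine Subtype.ext (hfix z ?_)
      rcases hz with hz | ⟨h2, ⟨a, b, hab⟩, hz⟩
      · exact Or.inl (congrArg Subtype.val hz)
      · exact Or.inr ⟨h2, ⟨a, b, fun h => hab (Subtype.ext h)⟩, congrArg Subtype.val hz⟩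
  have trick : ∀ x, φ (x⁻¹ * φ x) = x⁻¹ * φ x → φ x = x := fun x hx =>
    φ.apply_eq_of_apply_displacement_eq (hn x) hx (pow_orderOf_eq_one _)
      (hP.orderOf_coprime hnp.symm _).symm
  -- If the displacements generate a proper subgroup, it is invariant and fixed by induction.
  -- Otherwise they generate `P`, and everything centralizing all displacements is central.
  let D : Subgroup P := Subgroup.closure (Set.range fun x => x⁻¹ * φ x)
  have hDφ : ∀ x ∈ D, φ x ∈ D := by
    change D ≤ D.comap φ
    rw [Subgroup.closure_le]
    rintro _ ⟨x, rfl⟩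
    exact Subgroup.subset_closure ⟨φ x, by simp⟩
  by_cases hD : D ≠ ⊤
  · exact trick x (hinv D hD hDφ _ (Subgroup.subset_closure ⟨x, rfl⟩))
  push Not at hD
  rcases subsingleton_or_nontrivial P with _ | _
  · exact Subsingleton.elim _ _
  have hsurj : Function.Surjective φ := by
    have hn0 : n ≠ 0 := by
      rintro rfl
      exact hp.out.one_lt.ne' (by simpa using hnp)
    obtain ⟨k, rfl⟩ := Nat.exists_eq_succ_of_ne_zero hn0
    exact fun y => ⟨φ^[k] y, by rw [← Function.iterate_succ_apply' φ, hn]⟩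
  have hN : ∀ z ∈ frattini P, φ z = z :=
    hinv _ frattini_ne_top fun z hz => frattini_le_comap_frattini_of_surjective hsurj hz
  have hcent : ∀ z ∈ frattini P, ∀ a, Commute z a := by
    intro z hz a
    have hle : D ≤ Subgroup.centralizer {z} := by
      rw [Subgroup.closure_le]
      rintro _ ⟨b, rfl⟩
      rw [SetLike.mem_coe, Subgroup.mem_centralizer_singleton_iff]
      -- Both `z` and `b z b⁻¹` lie in the pointwise fixed Frattini subgroup, so the displacement of
      -- `b` centralizes `z`.
      have h1 : φ (b * z * b⁻¹) = b * z * b⁻¹ :=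
        hN _ ((inferInstance : (frattini P).Normal).conj_mem z hz b)
      rw [map_mul, map_mul, map_inv, hN z hz, mul_inv_eq_iff_eq_mul] at h1
      calc b⁻¹ * φ b * z = b⁻¹ * (φ b * z) := mul_assoc _ _ _
        _ = z * (b⁻¹ * φ b) := by rw [h1]; group
    have ha : a ∈ D := hD ▸ Subgroup.mem_top a
    exact ((Subgroup.mem_centralizer_singleton_iff).1 (hle ha)).symm
  apply trick
  apply hfix
  set a := x⁻¹
  set b := φ x
  set c := ⁅b⁻¹, a⁻¹⁆ with hc
  have hcz : c ∈ frattini P := hP.commutator_mem_frattini _ _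
  have hbac : b * a = a * b * c := by
    rw [hc, commutatorElement_def]; group
  have hca := hcent c hcz a
  have hcb := hcent c hcz b
  have hpow := mul_pow_eq_of_commute_commutator hca hcb hbac
  have hab : ∀ k, x ^ k ∈ frattini P → a ^ k * b ^ k = 1 := by
    intro k hk
    rw [inv_pow, ← map_pow, hN _ hk, inv_mul_cancel]
  -- Conjugation by `a` fixes the central element `b ^ p` but sends `b` to `b c`.
  have hcp : c ^ p = 1 := by
    have h1 : (a⁻¹ * b * a) ^ p = b ^ p := by
      have h2 := hcent _ (hP.pow_mem_frattini b) a
      have h3 : (a⁻¹ * b * a) ^ p = a⁻¹ * b ^ p * a := by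
        simpa using conj_pow (a := a⁻¹) (b := b) (i := p)
      rw [h3, mul_assoc, h2.eq, inv_mul_cancel_left]
    rw [mul_assoc, hbac, mul_assoc, inv_mul_cancel_left, hcb.symm.mul_pow] at h1
    exact mul_eq_left.1 h1
  by_cases hcomm : ∃ a b : P, a * b ≠ b * a
  · by_cases h2 : p = 2
    · right
      refine ⟨h2, hcomm, ?_⟩
      subst h2
      -- Exponent `4` is needed because `2.choose 2 = 1` is odd, whereas `4.choose 2 = 6` is even
      -- and kills `c`.
      have h4 : x ^ 4 ∈ frattini P := by
        rw [show 4 = 2 * 2 from rfl, pow_mul]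
        exact hP.pow_mem_frattini _
      rw [hpow, hab 4 h4, one_mul, show Nat.choose 4 2 = 2 * 3 from rfl, pow_mul, hcp, one_pow]
    · left
      have hdvd : p ∣ p.choose 2 := hp.out.dvd_choose_self (by norm_num)
        (lt_of_le_of_ne hp.out.two_le (Ne.symm h2))
      obtain ⟨t, ht⟩ := hdvd
      rw [hpow, hab p (hP.pow_mem_frattini x), one_mul, ht, pow_mul, hcp, one_pow]
  · left
    push Not at hcomm
    have hc1 : c = 1 := commutatorElement_eq_one_iff_mul_comm.2 (hcomm _ _)
    rw [hpow, hab p (hP.pow_mem_frattini x), hc1, one_pow, one_mul]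

/-! ### Elements with large prime divisors acting on `p`-subgroups -/

/-- All primes dividing the order of `y` exceed `p`. -/
def PrimesExceed {G : Type*} [Group G] (p : ℕ) (y : G) : Prop :=
  ∀ q : ℕ, q.Prime → q ∣ orderOf y → p < q

theorem PrimesExceed.map {G H : Type*} [Group G] [Group H] {p : ℕ} {y : G} (hy : PrimesExceed p y)
    (f : G →* H) : PrimesExceed p (f y) :=
  fun q hq hqd => hy q hq (hqd.trans (orderOf_map_dvd f y))

theorem PrimesExceed.coprime {G : Type*} [Group G] {p : ℕ} (hp : p.Prime) {y : G}
    (hy : PrimesExceed p y) : (orderOf y).Coprime p :=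
  ((Nat.Prime.coprime_iff_not_dvd hp).2 fun h => (hy p hp h).false).symm

/-- An element normalizing a cyclic `p`-subgroup centralizes it if its order has only prime divisors
exceeding `p`. -/
theorem PrimesExceed.commute_of_conj_mem_zpowers {G : Type*} [Group G] [Finite G] {p : ℕ}
    (hp : p.Prime) {y z : G} (hy : PrimesExceed p y) {a : ℕ} (hz : z ^ p ^ a = 1)
    (h : y * z * y⁻¹ ∈ Subgroup.zpowers z) : Commute y z := by
  have hyN : y ∈ Subgroup.normalizer (Subgroup.zpowers z : Set G) := by
    have hle : (Subgroup.zpowers z).map (MulAut.conj y).toMonoidHom ≤ Subgroup.zpowers z := by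
      rw [MonoidHom.map_zpowers, Subgroup.zpowers_le]
      exact h
    rw [Subgroup.mem_normalizer_iff_map_conj_eq]
    refine Subgroup.eq_of_le_of_card_ge hle ?_
    exact (Subgroup.card_map_of_injective (MulAut.conj y).injective).ge
  let f := Subgroup.normalizerMonoidHom (Subgroup.zpowers z)
  have h1 : orderOf (f ⟨y, hyN⟩) ∣ orderOf y :=
    (orderOf_map_dvd f _).trans (by rw [Subgroup.orderOf_mk])
  -- The automorphism group has order `p ^ (b - 1) * (p - 1)` for `b > 0`, with no prime factor
  -- above `p`.
  have h2 : orderOf (f ⟨y, hyN⟩) ∣ Nat.totient (orderOf z) := by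
    rw [← Nat.card_zpowers z, ← IsCyclic.card_mulAut]
    exact orderOf_dvd_natCard _
  obtain ⟨b, -, hb⟩ := (Nat.dvd_prime_pow hp).1 (orderOf_dvd_of_pow_eq_one hz)
  have h3 : orderOf (f ⟨y, hyN⟩) = 1 := by
    by_contra hne
    obtain ⟨q, hq, hqd⟩ := Nat.exists_prime_and_dvd hne
    have hpq := hy q hq (hqd.trans h1)
    have h4 := hqd.trans h2
    rw [hb] at h4
    rcases Nat.eq_zero_or_pos b with rfl | hb0
    · rw [pow_zero, Nat.totient_one] at h4
      exact hq.one_lt.ne' (Nat.dvd_one.1 h4)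
    · rw [Nat.totient_prime_pow hp hb0] at h4
      rcases (Nat.Prime.dvd_mul hq).1 h4 with h5 | h5
      · exact hpq.ne ((Nat.prime_dvd_prime_iff_eq hq hp).1 (hq.dvd_of_dvd_pow h5)).symm
      · have := Nat.le_of_dvd (Nat.sub_pos_of_lt hp.one_lt) h5
        omega
  have h6 : (⟨y, hyN⟩ : Subgroup.normalizer (Subgroup.zpowers z : Set G)) ∈ f.ker :=
    orderOf_eq_one_iff.1 h3
  rw [Subgroup.normalizerMonoidHom_ker, Subgroup.mem_subgroupOf, Subgroup.mem_centralizer_iff] at h6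
  exact (h6 z (Subgroup.mem_zpowers z)).symm

theorem commute_of_commute_displacement {G : Type*} [Group G] {x y : G} {m : ℕ}
    (h : Commute y (x⁻¹ * (y * x * y⁻¹))) (hm : (x⁻¹ * (y * x * y⁻¹)) ^ m = 1)
    (hym : (orderOf y).Coprime m) : Commute y x := by
  have hiter : ∀ k : ℕ, (MulAut.conj y).toMonoidHom^[k] x = y ^ k * x * (y ^ k)⁻¹ := by
    intro k
    induction k with
    | zero => simp
    | succ k ih =>
      rw [Function.iterate_succ_apply', ih, pow_succ']
      simp [mul_assoc]
  have h1 := (MulAut.conj y).toMonoidHom.apply_eq_of_apply_displacement_eq (n := orderOf y) (m := m)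
    (x := x) (by rw [hiter, pow_orderOf_eq_one]; simp) (mul_inv_eq_of_eq_mul h.eq) hm hym
  exact mul_inv_eq_iff_eq_mul.1 h1

/-- An element of order prime to `p` normalizing a `p`-subgroup and acting trivially on the factors of a series
centralizes the intersection with each term. -/
theorem PrimesExceed.commute_of_chain {G : Type*} [Group G] {p : ℕ} (hp : p.Prime) {y : G}
    (hy : PrimesExceed p y) {P : Subgroup G} (hP : IsPGroup p P)
    (hyP : y ∈ Subgroup.normalizer (P : Set G)) (N : ℕ → Subgroup G) (h0 : N 0 = ⊥) {n : ℕ}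
    (hN : ∀ i < n, ∀ x ∈ P, x ∈ N (i + 1) → x⁻¹ * (y * x * y⁻¹) ∈ N i) :
    ∀ i ≤ n, ∀ x ∈ P, x ∈ N i → Commute y x := by
  intro i
  induction i with
  | zero =>
    intro _ x _ hx
    rw [h0, Subgroup.mem_bot] at hx
    exact hx ▸ Commute.one_right y
  | succ i ih =>
    intro hi x hx hxN
    have hmem : x⁻¹ * (y * x * y⁻¹) ∈ P :=
      mul_mem (inv_mem hx) ((Subgroup.mem_normalizer_iff.1 hyP x).1 hx)
    obtain ⟨k, hk⟩ := hP ⟨_, hmem⟩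
    -- The displacement of `x` lies one term lower, where `y` already commutes, and its order is a
    -- power of `p`, prime to that of `y`.
    exact commute_of_commute_displacement (ih (by omega) _ hmem (hN i (by omega) x hx hxN))
      (congrArg Subtype.val hk) ((hy.coprime hp).pow_right k)

theorem PrimesExceed.commute_of_mem_hypercenter {G : Type*} [Group G] {p : ℕ} (hp : p.Prime)
    {y : G} (hy : PrimesExceed p y) {P : Subgroup G} (hP : IsPGroup p P)
    (hyP : y ∈ Subgroup.normalizer (P : Set G)) {x : G} (hx : x ∈ P)
    (hxZ : x ∈ hypercenter G) : Commute y x := by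
  obtain ⟨n, hn⟩ := (Subgroup.mem_iSup_of_directed
    (Subgroup.upperCentralSeries_mono G).directed_le).1 hxZ
  refine hy.commute_of_chain hp hP hyP (Subgroup.upperCentralSeries G)
    (Subgroup.upperCentralSeries_zero G) (n := n) ?_ n le_rfl x hx hn
  intro i _ x _ hxi
  have h := Subgroup.mem_upperCentralSeries_succ_iff.1 (inv_mem hxi) y
  simpa [commutatorElement_def, mul_assoc] using h

/-- Modulo `N i`, conjugation by `y` raises every element of the cyclic factor to one fixed power.
So `y` normalizes, and hence centralizes, the image of `⟨x⟩`, and the series argument applies. -/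
theorem PrimesExceed.commute_of_isSupersoluble {G : Type*} [Group G] [Finite G]
    (hG : IsSupersoluble G) {p : ℕ} (hp : p.Prime) {y : G} (hy : PrimesExceed p y)
    {P : Subgroup G} (hP : IsPGroup p P) (hyP : y ∈ Subgroup.normalizer (P : Set G)) {x : G}
    (hx : x ∈ P) : Commute y x := by
  obtain ⟨n, N, hnormal, h0, hn, hN⟩ := hG
  refine hy.commute_of_chain hp hP hyP N h0 (n := n) ?_ n le_rfl x hx (hn ▸ Subgroup.mem_top x)
  intro i hi x hx hxi
  obtain ⟨hle, hcyc⟩ := hN i hi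
  have := hnormal i
  let π := QuotientGroup.mk' (N i)
  obtain ⟨g, hg⟩ : ∃ g ∈ N (i + 1), ∀ u ∈ N (i + 1), ∃ k : ℤ, π u = π g ^ k := by
    obtain ⟨g, hg⟩ := hcyc.exists_generator
    obtain ⟨g, rfl⟩ := QuotientGroup.mk_surjective g
    refine ⟨g, g.2, fun u hu => ?_⟩
    obtain ⟨k, hk⟩ := hg (QuotientGroup.mk ⟨u, hu⟩)
    refine ⟨k, ?_⟩
    have hk' : ((g ^ k : N (i + 1)) : N (i + 1) ⧸ (N i).subgroupOf (N (i + 1))) =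
      ((⟨u, hu⟩ : N (i + 1)) : N (i + 1) ⧸ (N i).subgroupOf (N (i + 1))) := hk
    rw [QuotientGroup.eq, Subgroup.mem_subgroupOf] at hk'
    rw [← map_zpow]
    exact (QuotientGroup.eq.2 (by simpa using hk')).symm
  obtain ⟨k, hk⟩ := hg.2 x hxi
  obtain ⟨m, hm⟩ := hg.2 (y * g * y⁻¹) ((hnormal (i + 1)).conj_mem g hg.1 y)
  obtain ⟨j, hj⟩ := hP ⟨x, hx⟩
  have hj' : x ^ p ^ j = 1 := congrArg Subtype.val hj
  have hcomm : Commute (π y) (π x) := by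
    refine (hy.map π).commute_of_conj_mem_zpowers hp (a := j)
      (by rw [← map_pow, hj', map_one]) ⟨m, ?_⟩
    change π x ^ m = _
    rw [map_mul, map_mul, map_inv] at hm
    rw [hk, ← conj_zpow, hm, ← zpow_mul, ← zpow_mul, mul_comm]
  rw [← QuotientGroup.ker_mk' (N i), MonoidHom.mem_ker]
  change π (x⁻¹ * (y * x * y⁻¹)) = 1
  rw [map_mul, map_mul, map_mul, map_inv, map_inv, hcomm.eq, mul_inv_cancel_right, inv_mul_cancel]

/-! ### Supplements and cyclic subgroups -/

/-- `H` acts transitively on `G ⧸ T`, so the index is an orbit length. -/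
theorem Subgroup.index_dvd_card_of_mul_eq_univ {G : Type*} [Group G] [Finite G] {H T : Subgroup G}
    (h : (H : Set G) * (T : Set G) = Set.univ) : T.index ∣ Nat.card H := by
  have horb : MulAction.orbit H ((1 : G) : G ⧸ T) = Set.univ := by
    rw [Set.eq_univ_iff_forall]
    intro x
    obtain ⟨g, rfl⟩ := QuotientGroup.mk_surjective x
    obtain ⟨a, ha, t, ht, rfl⟩ := Set.mem_mul.1 (h ▸ Set.mem_univ g)
    refine ⟨⟨a, ha⟩, ?_⟩
    change ((a * 1 : G) : G ⧸ T) = _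
    rw [QuotientGroup.eq]
    simpa using ht
  have h1 := MulAction.index_stabilizer H ((1 : G) : G ⧸ T)
  rw [horb, Set.ncard_univ] at h1
  change Nat.card (G ⧸ T) ∣ _
  exact h1 ▸ Subgroup.index_dvd_card _

/-- If a cyclic subgroup is transitive on an even number of cosets, its generator acts as an odd
permutation. -/
theorem not_mem_commutator_of_zpowers_mul_eq_univ {G : Type*} [Group G] [Finite G] {h : G}
    {T : Subgroup G} (hT : (Subgroup.zpowers h : Set G) * (T : Set G) = Set.univ) (heven : Even T.index) :
    h ∉ commutator G := by
  classical
  have := Fintype.ofFinite (G ⧸ T)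
  let f : Equiv.Perm (G ⧸ T) := MulAction.toPermHom G (G ⧸ T) h
  have hpow : ∀ (i : ℤ) (x : G ⧸ T), (f ^ i) x = h ^ i • x := by
    intro i x
    rw [← map_zpow]; rfl
  have hreach : ∀ x : G ⧸ T, ∃ i : ℤ, x = h ^ i • ((1 : G) : G ⧸ T) := by
    intro x
    obtain ⟨g, rfl⟩ := QuotientGroup.mk_surjective x
    obtain ⟨_, ⟨i, rfl⟩, t, ht, rfl⟩ := Set.mem_mul.1 (hT ▸ Set.mem_univ g)
    refine ⟨i, Eq.symm ?_⟩
    change ((h ^ i * 1 : G) : G ⧸ T) = _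
    rw [QuotientGroup.eq]
    simpa using ht
  have hcard : Fintype.card (G ⧸ T) = T.index := by
    rw [← Nat.card_eq_fintype_card]; rfl
  have htwo : 1 < Fintype.card (G ⧸ T) := by
    have := T.index_ne_zero_of_finite
    obtain ⟨k, hk⟩ := heven
    omega
  have hnt : (Set.univ : Set (G ⧸ T)).Nontrivial := by
    rw [Set.nontrivial_univ_iff]
    exact Fintype.one_lt_card_iff_nontrivial.1 htwo
  have hcyc : f.IsCycleOn Set.univ := by
    refine ⟨⟨fun _ _ => Set.mem_univ _, f.injective.injOn, fun x _ =>
      (f.surjective x).imp fun _ h => ⟨Set.mem_univ _, h⟩⟩, ?_⟩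
    intro x _ y _
    obtain ⟨i, rfl⟩ := hreach x
    obtain ⟨j, rfl⟩ := hreach y
    refine ⟨j - i, ?_⟩
    rw [hpow, smul_smul, ← zpow_add, sub_add_cancel]
  have hcycle : f.IsCycle :=
    Equiv.Perm.isCycle_iff_exists_isCycleOn.2 ⟨_, hnt, hcyc, fun x _ => Set.mem_univ x⟩
  have hsupp : f.support = Finset.univ := by
    ext x
    simpa using hcyc.apply_ne hnt (Set.mem_univ x)
  -- A cycle of even length is odd, while the sign, having abelian target, kills the commutator
  -- subgroup.
  have hsign : Equiv.Perm.sign f = -1 := by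
    rw [hcycle.sign, hsupp, Finset.card_univ, hcard, heven.neg_one_pow]
  intro hmem
  have hker := Abelianization.commutator_subset_ker
    (Equiv.Perm.sign.comp (MulAction.toPermHom G (G ⧸ T))) hmem
  rw [MonoidHom.mem_ker] at hker
  change Equiv.Perm.sign f = 1 at hker
  rw [hsign] at hker
  exact absurd hker (by decide)

/-- All proper subgroups of `⟨z⟩` lie in `⟨z ^ p⟩`, so two of them cannot generate it. -/
theorem eq_zpowers_or_eq_zpowers_of_sup_eq {G : Type*} [Group G] {p : ℕ} (hp : p.Prime) {z : G}
    {k : ℕ} (hz : orderOf z = p ^ (k + 1)) {A B : Subgroup G} (h : Subgroup.zpowers z = A ⊔ B) :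
    A = Subgroup.zpowers z ∨ B = Subgroup.zpowers z := by
  have key : ∀ C : Subgroup G, C ≤ Subgroup.zpowers z → z ∉ C → C ≤ Subgroup.zpowers (z ^ p) := by
    intro C hC hzC x hx
    obtain ⟨i, rfl⟩ := hC hx
    change z ^ i ∈ C at hx
    by_cases hpi : (p : ℤ) ∣ i
    · obtain ⟨j, rfl⟩ := hpi
      exact ⟨j, by simp [zpow_mul]⟩
    · exfalso
      refine hzC (Subgroup.mem_of_pow_mem_of_coprime (a := i.natAbs) (b := p ^ (k + 1)) ?_ ?_ ?_)
      · rcases Int.natAbs_eq i with hi | hi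
        · rw [← zpow_natCast, ← hi]; exact hx
        · rw [← zpow_natCast, ← inv_mem_iff, ← zpow_neg, ← hi]; exact hx
      · rw [← hz, pow_orderOf_eq_one]; exact one_mem _
      · refine Nat.Coprime.pow_right _ ((Nat.Prime.coprime_iff_not_dvd hp).2 ?_).symm
        exact fun hd => hpi (Int.natCast_dvd.2 hd)
  by_contra hcon
  push Not at hcon
  have hA : z ∉ A := fun hzA =>
    hcon.1 (le_antisymm (h ▸ le_sup_left) (Subgroup.zpowers_le.2 hzA))
  have hB : z ∉ B := fun hzB =>
    hcon.2 (le_antisymm (h ▸ le_sup_right) (Subgroup.zpowers_le.2 hzB))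
  have hle : A ⊔ B ≤ Subgroup.zpowers (z ^ p) :=
    sup_le (key A (h ▸ le_sup_left) hA) (key B (h ▸ le_sup_right) hB)
  have h1 := orderOf_dvd_of_mem_zpowers (hle (h ▸ Subgroup.mem_zpowers z))
  have h2 : (z ^ p) ^ p ^ k = 1 := by
    rw [← pow_mul, ← pow_succ', ← hz, pow_orderOf_eq_one]
  have h3 := h1.trans (orderOf_dvd_of_pow_eq_one h2)
  rw [hz, Nat.pow_dvd_pow_iff_le_right hp.one_lt] at h3
  omega

/-! ### Modular and `𝓗`-permutable cyclic subgroups -/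

theorem IsPGroup.eq_one_of_orderOf_coprime {G : Type*} [Group G] {p : ℕ} {P : Subgroup G}
    (hP : IsPGroup p P) {x : G} (hx : x ∈ P) {m : ℕ} (hm : x ^ m = 1) (hmp : m.Coprime p) :
    x = 1 := by
  obtain ⟨k, hk⟩ := hP ⟨x, hx⟩
  have := pow_gcd_eq_one.2 ⟨hm, congrArg Subtype.val hk⟩
  rwa [(hmp.pow_right k).gcd_eq_one, pow_one] at this

/-- Since `⟨y⟩ ∩ P = 1`, the modular law gives `⟨z⟩ = ⟨z, y⟩ ∩ P`, which contains `y z y⁻¹`; thus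
`y` normalizes `⟨z⟩`. -/
theorem PrimesExceed.commute_of_isModularSubgroup {G : Type*} [Group G] [Finite G] {p : ℕ}
    (hp : p.Prime) {y : G} (hy : PrimesExceed p y) {P : Subgroup G} (hP : IsPGroup p P)
    (hyP : y ∈ Subgroup.normalizer (P : Set G)) {z : G} (hz : z ∈ P)
    (hmod : IsModularSubgroup (Subgroup.zpowers z)) : Commute y z := by
  have h := hmod.2 (Subgroup.zpowers y) P (Subgroup.zpowers_le.2 hz)
  have hbot : Subgroup.zpowers y ⊓ P = ⊥ := by
    rw [eq_bot_iff]
    rintro _ ⟨⟨i, rfl⟩, hiP⟩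
    refine hP.eq_one_of_orderOf_coprime hiP (m := orderOf y) ?_ (hy.coprime hp)
    change (y ^ i) ^ orderOf y = 1
    rw [← zpow_natCast, zpow_comm, zpow_natCast, pow_orderOf_eq_one, one_zpow]
  rw [hbot, sup_bot_eq] at h
  obtain ⟨k, hk⟩ := hP ⟨z, hz⟩
  refine hy.commute_of_conj_mem_zpowers hp (congrArg Subtype.val hk) ?_
  rw [h]
  have hyL : y ∈ Subgroup.zpowers z ⊔ Subgroup.zpowers y :=
    Subgroup.mem_sup_right (Subgroup.mem_zpowers y)
  exact Subgroup.mem_inf.2 ⟨mul_mem (mul_mem hyL (Subgroup.mem_sup_left (Subgroup.mem_zpowers z))) (inv_mem hyL),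
    (Subgroup.mem_normalizer_iff.1 hyP z).1 hz⟩

theorem Subgroup.exists_coe_eq_mul {G : Type*} [Group G] {H A : Subgroup G}
    (h : (H : Set G) * A = (A : Set G) * H) : ∃ L : Subgroup G, (L : Set G) = (H : Set G) * A :=
  ⟨{ carrier := (H : Set G) * A
     mul_mem' := by
      intro a b ha hb
      have := Set.mul_mem_mul ha hb
      rwa [mul_assoc, ← mul_assoc (A : Set G), ← h, mul_assoc (H : Set G), ← mul_assoc (H : Set G),
        coe_mul_coe, coe_mul_coe] at this
     one_mem' := ⟨1, one_mem _, 1, one_mem _, one_mul 1⟩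
     inv_mem' := by
      rintro _ ⟨a, ha, b, hb, rfl⟩
      rw [h]
      exact ⟨b⁻¹, A.inv_mem hb, a⁻¹, H.inv_mem ha, (mul_inv_rev a b).symm⟩ }, rfl⟩

theorem Subgroup.subgroupOf_mul_subgroupOf_eq_univ {G : Type*} [Group G] {H A L : Subgroup G}
    (hL : (L : Set G) = (H : Set G) * A) :
    H ≤ L ∧ A ≤ L ∧ (H.subgroupOf L : Set L) * (A.subgroupOf L : Set L) = Set.univ := by
  have hH : H ≤ L := by
    intro x hx
    rw [← SetLike.mem_coe, hL]
    exact ⟨x, hx, 1, one_mem _, mul_one x⟩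
  have hA : A ≤ L := by
    intro x hx
    rw [← SetLike.mem_coe, hL]
    exact ⟨1, one_mem _, x, hx, one_mul x⟩
  refine ⟨hH, hA, Set.eq_univ_iff_forall.2 fun x => ?_⟩
  have hx : (x : G) ∈ (H : Set G) * A := hL ▸ x.2
  obtain ⟨a, ha, b, hb, hab⟩ := hx
  exact ⟨⟨a, hH ha⟩, ha, ⟨b, hA hb⟩, hb, Subtype.ext hab⟩

/-- In the subgroup `L = ⟨z⟩A` the index of `A` is a power of `p ∈ s`, yet it divides `|G : A|`,
which has no prime factor in `s`. -/
theorem IsHallSubgroup.mem_of_mul_comm {G : Type*} [Group G] [Finite G] {s : Set Nat.Primes}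
    {A : Subgroup G} (hA : IsHallSubgroup s A) {p : Nat.Primes} (hps : p ∈ s) {z : G} {k : ℕ}
    (hz : orderOf z = (p : ℕ) ^ k)
    (h : (Subgroup.zpowers z : Set G) * A = (A : Set G) * Subgroup.zpowers z) : z ∈ A := by
  obtain ⟨L, hL⟩ := Subgroup.exists_coe_eq_mul h
  obtain ⟨hHL, hAL, huniv⟩ := Subgroup.subgroupOf_mul_subgroupOf_eq_univ hL
  have h1 : A.relIndex L ∣ (p : ℕ) ^ k := by
    rw [← hz, ← Nat.card_zpowers, ← Nat.card_congr (Subgroup.subgroupOfEquivOfLe hHL).toEquiv]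
    exact Subgroup.index_dvd_card_of_mul_eq_univ huniv
  obtain ⟨j, -, hj⟩ := (Nat.dvd_prime_pow p.2).1 h1
  have h2 : A.relIndex L = 1 := by
    rcases Nat.eq_zero_or_pos j with rfl | hj0
    · rw [hj, pow_zero]
    · exact absurd hps (hA.2 p ((hj ▸ dvd_pow_self _ hj0.ne').trans
        (Subgroup.relIndex_dvd_index_of_le hAL)))
  exact Subgroup.relIndex_eq_one.1 h2 (hHL (Subgroup.mem_zpowers z))

/-- A subgroup of order prime to `p` which has a cyclic `p`-subgroup as a supplement is normal, when
`p` is the smallest prime divisor of the group order. -/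
theorem Subgroup.normal_of_zpowers_mul_eq_univ {L : Type*} [Group L] [Finite L] {p : ℕ}
    (hp : p.Prime) (hmin : ∀ q : ℕ, q.Prime → q ∣ Nat.card L → p ≤ q) {z : L} {k : ℕ}
    (hz : orderOf z = p ^ k) {A : Subgroup L} (hA : (Nat.card A).Coprime p)
    (h : (Subgroup.zpowers z : Set L) * (A : Set L) = Set.univ) : A.Normal := by
  have hidx := Subgroup.index_dvd_card_of_mul_eq_univ h
  rw [Nat.card_zpowers, hz] at hidx
  rcases Nat.eq_zero_or_pos k with rfl | hk
  · rw [pow_zero, Nat.dvd_one, Subgroup.index_eq_one] at hidx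
    rw [hidx]; infer_instance
  have := Fact.mk hp
  have hpL : p ∣ Nat.card L := (hz ▸ dvd_pow_self p hk.ne').trans (_root_.orderOf_dvd_natCard z)
  have hminFac : (Nat.card L).minFac = p := by
    refine le_antisymm (Nat.minFac_le_of_dvd hp.two_le hpL) (hmin _ (Nat.minFac_prime ?_)
      (Nat.minFac_dvd _))
    exact fun h1 => hp.one_lt.ne' (Nat.dvd_one.1 (h1 ▸ hpL))
  have hZ : IsPGroup p (Subgroup.zpowers z) := IsPGroup.of_card (n := k) (by rw [Nat.card_zpowers, hz])
  obtain ⟨Q, hQ⟩ := hZ.exists_le_sylow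
  have hcardA := A.card_mul_index
  have hQcard : Nat.card Q ∣ p ^ k := by
    obtain ⟨j, hj⟩ := IsPGroup.iff_card.1 Q.2
    have h1 : Nat.card Q ∣ Nat.card A * A.index := hcardA ▸ Subgroup.card_subgroup_dvd_card _
    exact ((hj ▸ hA.symm.pow_left j : (Nat.card Q).Coprime (Nat.card A)).dvd_of_dvd_mul_left h1).trans
      hidx
  -- `⟨z⟩` is a cyclic Sylow subgroup for the smallest prime, so Burnside's transfer gives it a
  -- normal complement, which order comparison identifies with `A`.
  have hQeq : Subgroup.zpowers z = Q := by
    refine Subgroup.eq_of_le_of_card_ge hQ ?_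
    rw [Nat.card_zpowers, hz]
    exact Nat.le_of_dvd (pow_pos hp.pos k) hQcard
  have hQc : IsCyclic (Q : Subgroup L) := hQeq ▸ (inferInstance : IsCyclic (Subgroup.zpowers z))
  have hcompl := IsCyclic.isComplement' hminFac hQc
  set N := (MonoidHom.transferSylow Q (hQc.normalizer_le_centralizer hminFac)).ker
  have hNA : A ≤ N := by
    intro x hx
    refine Subgroup.mem_of_pow_mem_of_coprime (a := Nat.card A) (b := N.index) ?_
      (Subgroup.pow_index_mem _ _) ?_
    · have : x ^ Nat.card A = 1 := congrArg Subtype.val (pow_card_eq_one' (x := (⟨x, hx⟩ : A)))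
      rw [this]; exact one_mem _
    · rw [hcompl.symm.index_eq_card]
      exact Nat.Coprime.coprime_dvd_right hQcard (hA.pow_right k)
  have hAN : A = N := by
    refine Subgroup.eq_of_le_of_card_ge hNA ?_
    have h1 := hcompl.card_mul_card
    rw [← hQeq, Nat.card_zpowers, hz, ← hcardA] at h1
    have h2 := Nat.mul_le_mul_left (Nat.card A) (Nat.le_of_dvd (pow_pos hp.pos k) hidx)
    rw [← h1] at h2
    exact Nat.le_of_mul_le_mul_right h2 (pow_pos hp.pos k)
  rw [hAN]; infer_instance

/-- If `p ∈ s`, then `z` lies in the supersoluble group `A`. Otherwise `A` is a `p'`-group normal in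
`⟨z⟩A`, and `[z⁻¹, y]` lies in `A ∩ P = 1`. -/
theorem PrimesExceed.commute_of_mul_comm {G : Type*} [Group G] [Finite G] {p : ℕ} (hp : p.Prime)
    (hmin : ∀ q : ℕ, q.Prime → q ∣ Nat.card G → p ≤ q) {s : Set Nat.Primes} {A : Subgroup G}
    (hA : IsHallSubgroup s A) (hAs : IsSupersoluble A) {y : G} (hyA : y ∈ A)
    (hy : PrimesExceed p y) {P : Subgroup G} (hP : IsPGroup p P)
    (hyP : y ∈ Subgroup.normalizer (P : Set G)) {z : G} (hzP : z ∈ P) {k : ℕ}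
    (hz : orderOf z = p ^ k)
    (h : (Subgroup.zpowers z : Set G) * A = (A : Set G) * Subgroup.zpowers z) : Commute y z := by
  by_cases hps : (⟨p, hp⟩ : Nat.Primes) ∈ s
  · have hzA : z ∈ A := hA.mem_of_mul_comm hps hz h
    have hyA' : PrimesExceed p (⟨y, hyA⟩ : A) := by
      intro q hq hqd
      rw [Subgroup.orderOf_mk] at hqd
      exact hy q hq hqd
    have hPA : IsPGroup p (P.subgroupOf A) := hP.comap_subtype
    have hyN : (⟨y, hyA⟩ : A) ∈ Subgroup.normalizer (P.subgroupOf A : Set A) := by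
      rw [Subgroup.mem_normalizer_iff]
      exact fun x => Subgroup.mem_normalizer_iff.1 hyP x
    exact congrArg Subtype.val
      (hyA'.commute_of_isSupersoluble hAs hp hPA hyN (x := ⟨z, hzA⟩) hzP).eq
  · have hAp : (Nat.card A).Coprime p :=
      ((Nat.Prime.coprime_iff_not_dvd hp).2 fun hd => hps (hA.1 ⟨p, hp⟩ hd)).symm
    obtain ⟨L, hL⟩ := Subgroup.exists_coe_eq_mul h
    obtain ⟨hHL, hAL, huniv⟩ := Subgroup.subgroupOf_mul_subgroupOf_eq_univ hL
    have hzL : z ∈ L := hHL (Subgroup.mem_zpowers z)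
    have hzp : (Subgroup.zpowers z).subgroupOf L = Subgroup.zpowers (⟨z, hzL⟩ : L) := by
      rw [← Subgroup.map_subtype_inj, Subgroup.subgroupOf_map_subtype, inf_of_le_left hHL,
        MonoidHom.map_zpowers]
      rfl
    rw [hzp] at huniv
    have hnorm : (A.subgroupOf L).Normal := by
      refine Subgroup.normal_of_zpowers_mul_eq_univ hp
        (fun q hq hqd => hmin q hq (hqd.trans (Subgroup.card_subgroup_dvd_card L)))
        (by rw [Subgroup.orderOf_mk, hz]) ?_ huniv
      rwa [Nat.card_congr (Subgroup.subgroupOfEquivOfLe hAL).toEquiv]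
    have h1 : z⁻¹ * y * z ∈ A := by
      have := hnorm.conj_mem ⟨y, hAL hyA⟩ hyA (⟨z, hzL⟩ : L)⁻¹
      simpa [Subgroup.mem_subgroupOf] using this
    have h2 : z⁻¹ * (y * z * y⁻¹) ∈ A := by
      have := mul_mem h1 (inv_mem hyA)
      simpa [mul_assoc] using this
    have h3 : z⁻¹ * (y * z * y⁻¹) ∈ P :=
      mul_mem (inv_mem hzP) ((Subgroup.mem_normalizer_iff.1 hyP z).1 hzP)
    have h4 : z⁻¹ * (y * z * y⁻¹) = 1 := hP.eq_one_of_orderOf_coprime h3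
      (congrArg Subtype.val (pow_card_eq_one' (x := (⟨_, h2⟩ : A)))) hAp
    exact mul_inv_eq_iff_eq_mul.1 (inv_mul_eq_one.1 h4).symm

/-! ### Weak permutability inside the commutator subgroup -/

/-- A weakly `m`-`𝓗`-permutable subgroup generated by an element of the commutator subgroup, of order
`p` (the smallest prime divisor of `|G|`) or `4`, is modular or `𝓗`-permutable. -/
theorem IsWeaklyMHPermutable.isModularSubgroup_or_isHPermutable {G : Type*} [Group G] [Finite G]
    {σ : Set (Set Nat.Primes)} {𝓗 : Set (Subgroup G)} {p : ℕ} (hp : p.Prime)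
    (hmin : ∀ q : ℕ, q.Prime → q ∣ Nat.card G → p ≤ q) {z : G} (hzG : z ∈ commutator G)
    (hz : orderOf z = p ∨ orderOf z = 4 ∧ p = 2)
    (h : IsWeaklyMHPermutable σ 𝓗 (Subgroup.zpowers z)) :
    IsModularSubgroup (Subgroup.zpowers z) ∨ IsHPermutable 𝓗 (Subgroup.zpowers z) := by
  obtain ⟨k, hk⟩ : ∃ k, orderOf z = p ^ (k + 1) := by
    rcases hz with hz | ⟨hz, rfl⟩
    · exact ⟨0, by rw [hz, zero_add, pow_one]⟩
    · exact ⟨1, hz⟩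
  obtain ⟨T, -, hT, S, ⟨A, B, hA, hB, hS⟩, hTS, hSH⟩ := h
  by_cases hTtop : T = ⊤
  · rw [hTtop, inf_top_eq] at hTS
    have hSe : Subgroup.zpowers z = A ⊔ B := hS ▸ le_antisymm hTS hSH
    rcases eq_zpowers_or_eq_zpowers_of_sup_eq hp hk hSe with h | h
    · exact Or.inl (h ▸ hA)
    · exact Or.inr (h ▸ hB)
  exfalso
  have hidx := Subgroup.index_dvd_card_of_mul_eq_univ hT
  rw [Nat.card_zpowers] at hidx
  have hne : T.index ≠ 1 := fun h => hTtop (Subgroup.index_eq_one.1 h)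
  have hpdvd : p ∣ T.index := by
    obtain ⟨j, -, hj⟩ := (Nat.dvd_prime_pow hp).1 (hk ▸ hidx)
    rw [hj]
    exact dvd_pow_self p fun hj0 => hne (by rw [hj, hj0, pow_zero])
  by_cases hp2 : p = 2
  · exact not_mem_commutator_of_zpowers_mul_eq_univ hT
      (even_iff_two_dvd.2 (hp2 ▸ hpdvd)) hzG
  -- For odd `p` the index is the smallest prime divisor of `|G|`, which forces `T` to be normal
  -- with abelian quotient; then `z ∈ T` and `G = ⟨z⟩T = T`.
  have hTp : T.index = p := by
    rcases hz with hz | ⟨-, h2⟩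
    · exact ((Nat.dvd_prime hp).1 (hz ▸ hidx)).resolve_left hne
    · exact absurd h2 hp2
  have hpG : p ∣ Nat.card G := hTp ▸ T.index_dvd_card
  have hTn : T.Normal := by
    refine Subgroup.normal_of_index_eq_minFac_card (hTp.trans (le_antisymm ?_ ?_))
    · exact hmin _ (Nat.minFac_prime fun h1 => hp.one_lt.ne' (Nat.dvd_one.1 (h1 ▸ hpG)))
        (Nat.minFac_dvd _)
    · exact Nat.minFac_le_of_dvd hp.two_le hpG
  have hzT : z ∈ T := Subgroup.commutator_le_of_index_prime hp hTp hzG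
  apply hTtop
  rw [Subgroup.eq_top_iff']
  intro g
  obtain ⟨a, ha, t, ht, rfl⟩ := Set.mem_mul.1 (hT ▸ Set.mem_univ g)
  exact mul_mem (Subgroup.zpowers_le.2 hzT ha) ht

/-! ### Verification of Frobenius's criterion -/

/-- A `q`-element of `G` lies in a conjugate of any subgroup of index prime to `q`. -/
theorem exists_conj_mem_of_not_dvd_index {G : Type*} [Group G] [Finite G] {q : ℕ} (hq : q.Prime)
    {A : Subgroup G} (hA : ¬ q ∣ A.index) {y : G} {k : ℕ} (hy : y ^ q ^ k = 1) :
    ∃ g : G, g⁻¹ * y * g ∈ A := by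
  have := Fact.mk hq
  have hY : IsPGroup q (Subgroup.zpowers y) :=
    IsPGroup.of_card_dvd_pow (n := k) (by rw [Nat.card_zpowers]; exact orderOf_dvd_of_pow_eq_one hy)
  obtain ⟨x, hx⟩ := hY.nonempty_fixed_point_of_prime_not_dvd_card (G ⧸ A) hA
  obtain ⟨g, rfl⟩ := QuotientGroup.mk_surjective x
  refine ⟨g, ?_⟩
  have h : ((y * g : G) : G ⧸ A) = (g : G ⧸ A) := hx ⟨y, Subgroup.mem_zpowers y⟩
  rw [eq_comm, QuotientGroup.eq] at h
  rwa [mul_assoc]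

theorem mainTheorem2 {G : Type*} [Group G] [Finite G]
    (σ : Set (Set Nat.Primes)) (hσ : Setoid.IsPartition σ)
    (hG : IsSigmaFullOfSylowType σ G)
    (𝓗 : Set (Subgroup G)) (h𝓗 : IsCompleteHallSet σ 𝓗)
    (hsuper : ∀ A ∈ 𝓗, IsSupersoluble A)
    (p : ℕ) (hp : p.Prime) (hpG : p ∣ Nat.card G)
    (hpmin : ∀ q : ℕ, q.Prime → q ∣ Nat.card G → p ≤ q)
    (hperm : ∀ H : Subgroup G, IsCyclic H → ¬ H ≤ hypercenter G →
      (Nat.card H = p ∨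
        (Nat.card H = 4 ∧ p = 2 ∧ ∃ P : Sylow 2 G, ∃ x ∈ P, ∃ y ∈ P, x * y ≠ y * x)) →
      IsWeaklyMHPermutable σ 𝓗 H) :
    IsPNilpotent p G := by
  have := Fact.mk hp
  have hsmall : ∀ (X : Subgroup G) (y z : G), IsPGroup p X → PrimesExceed p y →
      y ∈ Subgroup.normalizer (X : Set G) → (∃ s, ∃ A ∈ 𝓗, IsHallSubgroup s A ∧ y ∈ A) →
      z ∈ X → z ∈ commutator G → (orderOf z = p ∨
        (orderOf z = 4 ∧ p = 2 ∧ ∃ P : Sylow 2 G, ∃ x ∈ P, ∃ y ∈ P, x * y ≠ y * x)) →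
      Commute y z := by
    rintro X y z hX hy hyX ⟨s, A, hA𝓗, hA, hyA⟩ hzX hzG hz
    by_cases hZ : z ∈ hypercenter G
    · exact hy.commute_of_mem_hypercenter hp hX hyX hzX hZ
    have hw := hperm (Subgroup.zpowers z) inferInstance
      (fun h => hZ (h (Subgroup.mem_zpowers z))) (by rwa [Nat.card_zpowers])
    have hz' : orderOf z = p ∨ orderOf z = 4 ∧ p = 2 := hz.imp id fun h => ⟨h.1, h.2.1⟩
    rcases hw.isModularSubgroup_or_isHPermutable hp hpmin hzG hz' with h | h
    · exact hy.commute_of_isModularSubgroup hp hX hyX hzX h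
    · obtain ⟨k, hk⟩ : ∃ k, orderOf z = p ^ k := by
        rcases hz' with hz' | ⟨hz', rfl⟩
        · exact ⟨1, by rw [hz', pow_one]⟩
        · exact ⟨2, hz'⟩
      exact hy.commute_of_mul_comm hp hpmin hA (hsuper A hA𝓗) hyA hX hyX hzX hk (h A hA𝓗)
  have hcore : ∀ (X : Subgroup G) (y : G), IsPGroup p X → PrimesExceed p y →
      y ∈ Subgroup.normalizer (X : Set G) → (∃ s, ∃ A ∈ 𝓗, IsHallSubgroup s A ∧ y ∈ A) →
      ∀ x ∈ X, Commute y x := by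
    intro X y hX hy hyX hyA x hx
    let φ : X →* X := (Subgroup.normalizerMonoidHom X ⟨y, hyX⟩).toMonoidHom
    have hφ : ∀ x : X, (φ x : G) = y * x * y⁻¹ := fun _ => rfl
    have hiter : ∀ (k : ℕ) (x : X), ((φ^[k] x : X) : G) = y ^ k * x * (y ^ k)⁻¹ := by
      intro k x
      induction k with
      | zero => simp
      | succ k ih =>
        rw [Function.iterate_succ_apply', hφ, ih, pow_succ']
        simp only [mul_assoc, mul_inv_rev]
    have hfix := hX.apply_eq_of_iterate_eq φ (n := orderOf y)
      (fun x => Subtype.ext (by rw [hiter, pow_orderOf_eq_one]; simp)) (hy.coprime hp) ?_ ⟨x, hx⟩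
    · exact mul_inv_eq_iff_eq_mul.1 (congrArg Subtype.val hfix)
    intro x hx
    set z : X := x⁻¹ * φ x with hzdef
    refine Subtype.ext ((hφ z).trans (mul_inv_eq_iff_eq_mul.2 ?_))
    -- Being a displacement puts `z` in the commutator subgroup, which is what excludes proper
    -- supplements.
    have hzG : (z : G) ∈ commutator G := by
      have h : (z : G) = ⁅(x : G)⁻¹, y⁆ := by
        rw [hzdef, Subgroup.coe_mul, hφ, Subgroup.coe_inv, commutatorElement_def]
        group
      rw [h]
      exact Subgroup.commutator_mem_commutator (Subgroup.mem_top _) (Subgroup.mem_top _)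
    by_cases hz1 : z = 1
    · rw [hz1]; simp
    have hordp : z ^ p = 1 → Commute y z := fun h =>
      hsmall X y z hX hy hyX hyA z.2 hzG (Or.inl (by
        rw [Subgroup.orderOf_coe]; exact orderOf_eq_prime h hz1))
    rcases hx with h | ⟨rfl, ⟨a, b, hab⟩, h⟩
    · exact hordp h
    by_cases h2 : z ^ 2 = 1
    · exact hordp h2
    -- Non-commuting elements of `X` persist in a Sylow `2`-subgroup containing it, so the order `4`
    -- hypothesis is available.
    obtain ⟨P, hP⟩ := hX.exists_le_sylow
    refine hsmall X y z hX hy hyX hyA z.2 hzG (Or.inr ⟨?_, rfl, P, a, hP a.2, b, hP b.2,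
      fun h => hab (Subtype.ext h)⟩)
    rw [Subgroup.orderOf_coe]
    exact orderOf_eq_prime_pow (p := 2) (n := 1) (by simpa using h2) (by simpa using h)
  refine CentralizesNormalizedPSubgroups.isPNilpotent ?_
  intro X hX q hq hqp y k hyk hyX x hx
  by_cases hy1 : y = 1
  · exact hy1 ▸ Commute.one_left x
  have hyq : ∀ r : ℕ, r.Prime → r ∣ orderOf y → r = q := fun r hr hrd =>
    (Nat.prime_dvd_prime_iff_eq hr hq).1
      (hr.dvd_of_dvd_pow (hrd.trans (orderOf_dvd_of_pow_eq_one hyk)))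
  have hqG : q ∣ Nat.card G := by
    obtain ⟨r, hr, hrd⟩ := Nat.exists_prime_and_dvd (mt orderOf_eq_one_iff.1 hy1)
    exact hyq r hr hrd ▸ hrd.trans (orderOf_dvd_natCard y)
  have hy : PrimesExceed p y := fun r hr hrd => by
    rw [hyq r hr hrd]
    exact lt_of_le_of_ne (hpmin q hq hqG) (Ne.symm hqp)
  -- The block of `q` singles out the Hall subgroup whose index is prime to `q`. A conjugate of `y`
  -- lies in it, and commutation is transported back along the conjugation.
  obtain ⟨s, ⟨hs, hqs⟩, -⟩ := hσ.2 ⟨q, hq⟩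
  obtain ⟨A, ⟨hA𝓗, hA⟩, -⟩ := h𝓗.2 s ⟨hs, _, hqs, hqG⟩
  obtain ⟨g, hg⟩ := exists_conj_mem_of_not_dvd_index hq (fun hd => hA.2 ⟨q, hq⟩ hd hqs) hyk
  let f := (MulAut.conj g⁻¹).toMonoidHom
  have hf : ∀ u, f u = g⁻¹ * u * g := fun u => by simp [f]
  have h := hcore (X.map f) (f y) (hX.map f) (hy.map f)
    (Subgroup.le_normalizer_map f ⟨y, hyX, rfl⟩) ⟨s, A, hA𝓗, hA, by rwa [hf]⟩ (f x) ⟨x, hx, rfl⟩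
  exact (MulAut.conj g⁻¹).injective (((map_mul f y x).trans h.eq).trans (map_mul f x y).symm)
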